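/- Let $k$ be a field of characteristic zero, let $A$ be a commutative $k$-algebra, let $I$ be a free $A$-module of finite rank, and let $0\to I\to B\xrightarrow{\pi} A\to 0$ be a trivial square-zero extension of $A$ by $I$, i.e. $B$ is a commutative $k$-algebra, $\pi$ is a surjective morphism of $k$-algebras with kernel $I$, $I^2=0$, the $A$-module structure of $I$ is induced by the multiplication of $B$, and $\pi$ has a section that is a morphism of $k$-algebras. Complexes are graded homologically. For a complex $K_\bullet$ of $B$-modules that vanishes in all sufficiently negative homological degrees, let $K_\bullet\otimes^{\mathbb L}_B A$ be the derived pullback, i.e. the complex of $A$-modules $P_\bullet\otimes_B A$, where $P_\bullet\to K_\bullet$ is a quasi-isomorphism and $P_\bullet$ is a complex of projective $B$-modules that vanishes in all sufficiently negative degrees; put $\mathbf{Tor}^i_B(K_\bullet,A)=\mathrm H_i(K_\bullet\otimes^{\mathbb L}_B A)$, and let $\mathrm{Tor}^1_B(K_\bullet,A)$ be the complex of $A$-modules obtained by applying $\mathrm{Tor}^1_B(-,A)$ to each term of $K_\bullet$. The complex $K_\bullet$ is called admissible if $\mathrm H_i(\mathrm{Tor}^1_B(K_\bullet,A))=0$ for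 all $i\in\mathbb Z$. If $K_\bullet$ is concentrated in nonnegative homological degrees and $n\in\mathbb N\cup\{+\infty\}$, it is called $n$-admissible if $\mathrm H_i(\mathrm{Tor}^1_B(K_\bullet,A))=0$ for all $0\le i\le n-1$; thus admissible means $\infty$-admissible for such complexes. A complex of modules over a commutative ring is called perfect if it is isomorphic in the derived category to a bounded complex of finitely generated projective modules. Then the following hold. (1) Let $K_\bullet$ be a complex of $B$-modules concentrated in nonnegative homological degrees and let $n\in\mathbb N\cup\{+\infty\}$. Then $K_\bullet$ is $n$-admissible if and only if the natural map $\mathbf{Tor}^i_B(K_\bullet,A)\to \mathrm H_i(K_\bullet\otimes_B A)$ is an isomorphism for all $0\le i\le n$ and is surjective for $i=n+1$ (the last condition being empty if $n=+\infty$). (2) Let $m$ be an integer and let $K_\bullet$ be a complex of $B$-modules concentrated in homological degrees $\ge -m$. Then $K_\bullet$ is isomorphic in the derived category of $B$-modules to a bounded admissible complex concentrated in homological degrees $\ge -m$ if and only if $K_\bullet\otimes^{\mathbb L}_B A$ is cohomologically bounded, i.e. has nonzero homology only in a bounded range of degrees. (3) Let $K_\bullet$ be a bounded complex of $B$-modules.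 Then $K_\bullet$ is perfect if and only if $K_\bullet\otimes^{\mathbb L}_B A$ is perfect. -/

import Mathlib

open CategoryTheory Opposite

universe w u v

noncomputable section

/-! Complexes are `ℤ`-graded cochain complexes; the homological degree `i` is the cochain
degree `-i`. A complex concentrated in nonnegative homological degrees is one that satisfies
`K.IsStrictlyLE 0`. -/

/-- A trivial extension `0 → I → B → A → 0` of the commutative `k`-algebra `A` by the `A`-module
`I`: the ideal `I` of `B` has square zero, its `A`-module structure is the one induced by the
multiplication of `B`, and `B → A` has a section that is a morphism of `k`-algebras. -/
structure TrivialExtension (k : Type v) (A B : Type u) (I : Type w) [Field k]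
    [CommRing A] [Algebra k A] [CommRing B] [Algebra k B] [AddCommGroup I] [Module A I] where
  /-- the inclusion of the ideal -/
  ι : I →+ B
  /-- the projection -/
  π : B →ₐ[k] A
  ι_injective : Function.Injective ι
  π_surjective : Function.Surjective π
  exact : Function.Exact ι π
  sq_zero : ∀ i j : I, ι i * ι j = 0
  smul_eq : ∀ (b : B) (i : I), ι (π b • i) = b * ι i
  split : ∃ σ : A →ₐ[k] B, π.comp σ = AlgHom.id k A

namespace DerivedPullback

section Resolutions

variable {C : Type u} [Category.{v} C] [Abelian C]

theorem quasiIso_neg {K L : CochainComplex C ℤ} (f : K ⟶ L) [QuasiIso f] :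
    QuasiIso ((ChainComplex.cochainComplexEquivalence C).inverse.map f) where
  quasiIsoAt n := by
    rw [quasiIsoAt_iff' _ (n + 1) n (n - 1) (by simp) (by simp)]
    exact (quasiIsoAt_iff' f (-(n + 1)) (-n) (-(n - 1)) (by simp; lia)
      (by simp; lia)).1 inferInstance

theorem exists_projective_quasiIso [EnoughProjectives C] (K : CochainComplex C ℤ) (m : ℤ)
    [K.IsStrictlyLE m] :
    ∃ (P : CochainComplex C ℤ) (f : P ⟶ K), P.IsStrictlyLE m ∧
      (∀ i, Projective (P.X i)) ∧ QuasiIso f := by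
  let e := CochainComplex.opEquivalence C
  have : (e.functor.obj (op K)).IsStrictlyGE (-m) := by
    rw [CochainComplex.isStrictlyGE_iff]
    intro i hi
    exact (K.isZero_of_isStrictlyLE m (-i) (by lia)).op
  obtain ⟨J, i, _, hJ, _⟩ :=
    CochainComplex.Plus.modelCategoryQuillen.exists_quasiIso_injective
      (e.functor.obj (op K)) (-m)
  refine ⟨(e.inverse.obj J).unop,
    (e.inverse.map i).unop ≫ (e.unitIso.hom.app (op K)).unop, ?_, ?_, ?_⟩
  · rw [CochainComplex.isStrictlyLE_iff]
    intro i hi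
    exact (J.isZero_of_isStrictlyGE (-m) (-i) (by lia)).unop
  · intro i
    have := hJ (-i)
    exact inferInstanceAs (Projective (J.X (-i)).unop)
  · have h1 := quasiIso_neg i
    have : QuasiIso (e.inverse.map i).unop :=
      (HomologicalComplex.quasiIso_unopFunctor_map_iff (c := ComplexShape.down ℤ)
        ((ChainComplex.cochainComplexEquivalence _).inverse.map i)).2 h1
    have : IsIso (e.unitIso.hom.app (op K)).unop := inferInstance
    infer_instance

/-- `K` is bounded above as a cochain complex, i.e. an object of `C⁻`. -/
def IsBoundedAbove (K : CochainComplex C ℤ) : Prop := ∃ m : ℤ, K.IsStrictlyLE m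

/-- `K` is bounded below as a cochain complex. -/
def IsBoundedBelow (K : CochainComplex C ℤ) : Prop := ∃ m : ℤ, K.IsStrictlyGE m

/-- The cohomology of `K` vanishes outside a bounded range of degrees. -/
def IsCohomologicallyBounded (K : CochainComplex C ℤ) : Prop :=
  ∃ a b : ℤ, ∀ i : ℤ, i < a ∨ b < i → Limits.IsZero (K.homology i)

attribute [local instance] HasDerivedCategory.standard in
/-- `K` and `L` are isomorphic in the derived category. -/
def DerivedIso (K L : CochainComplex C ℤ) : Prop :=
  Nonempty (DerivedCategory.Q.obj K ≅ DerivedCategory.Q.obj L)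

/-- A projective resolution of a complex: a quasi-isomorphism from a bounded above complex of
projective objects. -/
structure ProjRes (K : CochainComplex C ℤ) where
  /-- the resolving complex -/
  P : CochainComplex C ℤ
  /-- the augmentation -/
  f : P ⟶ K
  boundedAbove : IsBoundedAbove P
  projective : ∀ i, Projective (P.X i)
  quasiIso : QuasiIso f

theorem nonempty_projRes [EnoughProjectives C] {K : CochainComplex C ℤ} (hK : IsBoundedAbove K) :
    Nonempty (ProjRes K) := by
  obtain ⟨m, hm⟩ := hK
  obtain ⟨P, f, h1, h2, h3⟩ := exists_projective_quasiIso K m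
  exact ⟨⟨P, f, ⟨m, h1⟩, h2, h3⟩⟩

/-- A chosen projective resolution of a bounded above complex; it is unique up to homotopy
equivalence. -/
def projRes [EnoughProjectives C] (K : CochainComplex C ℤ) (hK : IsBoundedAbove K) : ProjRes K :=
  (nonempty_projRes hK).some

end Resolutions

/-- A complex of `R`-modules is perfect if it is isomorphic in the derived category to a bounded
complex of finitely generated projective modules. -/
def IsPerfect {R : Type u} [CommRing R] (K : CochainComplex (ModuleCat.{u} R) ℤ) : Prop :=
  ∃ P : CochainComplex (ModuleCat.{u} R) ℤ, IsBoundedAbove P ∧ IsBoundedBelow P ∧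
    (∀ i, Module.Finite R (P.X i) ∧ Module.Projective R (P.X i)) ∧ DerivedIso K P

variable {A B : Type u} [CommRing A] [CommRing B] (π : B →+* A)

/-- The functor `V ↦ V ⊗_B A` from `B`-modules to `A`-modules. -/
def baseChange : ModuleCat.{u} B ⥤ ModuleCat.{u} A := ModuleCat.extendScalars.{u, u, u} π

instance : (baseChange π).Additive :=
  (ModuleCat.extendRestrictScalarsAdj.{u} π).left_adjoint_additive

/-- The functor `V ↦ Tor^p_B(V, A)` from `B`-modules to `A`-modules. -/
def tor (p : ℕ) : ModuleCat.{u} B ⥤ ModuleCat.{u} A := (baseChange π).leftDerived p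

instance (p : ℕ) : (tor π p).PreservesZeroMorphisms where
  map_zero X Y := by
    have h := Functor.leftDerived_map_eq (baseChange π) p (0 : X ⟶ Y)
      (P := projectiveResolution X) (Q := projectiveResolution Y) 0 (by simp)
    refine h.trans ?_
    rw [Functor.map_zero, Limits.zero_comp, Limits.comp_zero]
    rfl

/-- The functor `K ↦ K ⊗_B A` on complexes. -/
def pullback : CochainComplex (ModuleCat.{u} B) ℤ ⥤ CochainComplex (ModuleCat.{u} A) ℤ :=
  (baseChange π).mapHomologicalComplex (ComplexShape.up ℤ)

/-- The complex `Tor^1_B(K, A)`, obtained by applying `Tor^1_B(-, A)` to each term of `K`. -/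
def torOne (K : CochainComplex (ModuleCat.{u} B) ℤ) : CochainComplex (ModuleCat.{u} A) ℤ :=
  ((tor π 1).mapHomologicalComplex (ComplexShape.up ℤ)).obj K

/-- For `K` concentrated in nonnegative homological degrees: `K` is `n`-admissible if
`H_i(Tor^1_B(K, A)) = 0` for `0 ≤ i ≤ n - 1`. -/
def IsNAdmissible (n : ℕ∞) (K : CochainComplex (ModuleCat.{u} B) ℤ) : Prop :=
  ∀ i : ℕ, (i : ℕ∞) < n → Limits.IsZero ((torOne π K).homology (-(i : ℤ)))

/-- `K` is admissible if `Tor^1_B(K, A)` is acyclic. -/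
def IsAdmissible (K : CochainComplex (ModuleCat.{u} B) ℤ) : Prop :=
  ∀ i : ℤ, Limits.IsZero ((torOne π K).homology i)

/-- In nonnegative homological degrees, admissible means `∞`-admissible. -/
theorem isAdmissible_iff (K : CochainComplex (ModuleCat.{u} B) ℤ) [K.IsStrictlyLE 0] :
    IsAdmissible π K ↔ IsNAdmissible π ⊤ K := by
  refine ⟨fun h i _ => h _, fun h i => ?_⟩
  obtain hi | hi := le_or_gt i 0
  · obtain ⟨j, rfl⟩ : ∃ j : ℕ, i = -(j : ℤ) := ⟨i.natAbs, by lia⟩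
    exact h j (ENat.natCast_lt_top j)
  · refine HomologicalComplex.ExactAt.isZero_homology ?_
    exact HomologicalComplex.ExactAt.of_isZero
      ((tor π 1).map_isZero (K.isZero_of_isStrictlyLE 0 i hi))

/-- The derived pullback `K ⊗^L_B A` of a bounded above complex `K`, computed by a projective
resolution of `K`. -/
def derivedPullback (K : CochainComplex (ModuleCat.{u} B) ℤ) (hK : IsBoundedAbove K) :
    CochainComplex (ModuleCat.{u} A) ℤ :=
  (pullback π).obj (projRes K hK).P

/-- The natural morphism `K ⊗^L_B A ⟶ K ⊗_B A`. -/
def derivedPullbackTo (K : CochainComplex (ModuleCat.{u} B) ℤ) (hK : IsBoundedAbove K) :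
    derivedPullback π K hK ⟶ (pullback π).obj K :=
  (pullback π).map (projRes K hK).f

/-- The hypertor module `𝐓𝐨𝐫^i_B(K, A) = H_i(K ⊗^L_B A)`. -/
def hypertor (K : CochainComplex (ModuleCat.{u} B) ℤ) (hK : IsBoundedAbove K) (i : ℤ) :
    ModuleCat.{u} A :=
  (derivedPullback π K hK).homology (-i)

/-- The natural map from `𝐓𝐨𝐫^i_B(K, A)` to `H_i(K ⊗_B A)`. -/
def hypertorTo (K : CochainComplex (ModuleCat.{u} B) ℤ) (hK : IsBoundedAbove K) (i : ℤ) :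
    hypertor π K hK i ⟶ ((pullback π).obj K).homology (-i) :=
  HomologicalComplex.homologyMap (derivedPullbackTo π K hK) (-i)

end DerivedPullback

end

/-!
For a `B`-module `V` multiplication by `I` gives a natural right exact sequence
`I ⊗_A (V ⊗_B A) ⟶ V ⟶ V ⊗_B A ⟶ 0`, which is left exact when `V` is projective; the snake lemma
extends it to the left by `Tor^1_B(V, A)` for every `V`. For an acyclic complex `K` this four-term
exact sequence and the flatness of `I` link the homology of `K ⊗_B A` in degree `j` with that of
`Tor^1_B(K, A)` in degree `j + 2` as long as `K ⊗_B A` is exact in degrees `j + 1` and `j + 2`, so a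
descending induction applies; on the mapping cone of a projective resolution this is (1). For (2),
truncate a projective resolution `P` below the degrees where `P ⊗_B A` has homology: the cokernel
that appears there has no `Tor^1`. For (3), morphisms that vanish over `A` compose to zero, so the
differential of `Q ⊗_A B`, where `Q` is a perfect model of `K ⊗^L_B A`, can be corrected in one step
to make it quasi-isomorphic to `K`.
-/

noncomputable section

namespace DerivedPullback

open Limits HomologicalComplex CochainComplex

section Homology

variable {C : Type u} [Category.{v} C] [Abelian C]

theorem exactAt_iff_of_iso {C ι : Type*} [Category* C] [HasZeroMorphisms C] {c : ComplexShape ι}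
    {K L : HomologicalComplex C c} (e : K ≅ L) (i : ι) : K.ExactAt i ↔ L.ExactAt i :=
  ⟨fun h => h.of_iso e, fun h => h.of_iso e.symm⟩

attribute [local instance] HasDerivedCategory.standard in
theorem exactAt_mappingCone_iff {K L : CochainComplex C ℤ} (φ : K ⟶ L) (n m : ℤ)
    (h : n + 1 = m) :
    (mappingCone φ).ExactAt n ↔ Epi (homologyMap φ n) ∧ Mono (homologyMap φ m) := by
  have hT := DerivedCategory.mappingCone_triangle_distinguished φ
  have h₁ := homologyMap_exact₁_of_distTriang _ hT n m h
  have h₂ := homologyMap_exact₂_of_distTriang _ hT n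
  have h₃ := homologyMap_exact₃_of_distTriang _ hT n m h
  rw [exactAt_iff_isZero_homology]
  refine ⟨fun hz => ⟨h₂.epi_f (hz.eq_of_tgt _ _), h₁.mono_g (hz.eq_of_src _ _)⟩, ?_⟩
  rintro ⟨hepi, hmono⟩
  have : Epi (homologyMap (mappingCone.triangle φ).mor₁ n) := hepi
  have : Mono (homologyMap (mappingCone.triangle φ).mor₁ m) := hmono
  refine h₃.isZero_of_both_zeros ?_ ?_
  · rw [← cancel_epi (homologyMap (mappingCone.triangle φ).mor₁ n)]
    exact (homologyMap_comp_eq_zero_of_distTriang _ hT n).trans comp_zero.symm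
  · rw [← cancel_mono (homologyMap (mappingCone.triangle φ).mor₁ m)]
    exact (homologyδOfTriangle_homologyMap _ hT n m h).trans zero_comp.symm

theorem forall_exactAt_mappingCone_iff {K L : CochainComplex C ℤ} (φ : K ⟶ L) (a : ℤ) :
    (∀ j, a ≤ j → (mappingCone φ).ExactAt j) ↔
      Epi (homologyMap φ a) ∧ ∀ j, a < j → IsIso (homologyMap φ j) := by
  constructor
  · intro h
    have hepi (j : ℤ) (hj : a ≤ j) := ((exactAt_mappingCone_iff φ j _ rfl).1 (h j hj)).1
    refine ⟨hepi a le_rfl, fun j hj => ?_⟩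
    have := hepi j hj.le
    have := ((exactAt_mappingCone_iff φ (j - 1) j (by lia)).1 (h _ (by lia))).2
    exact isIso_of_mono_of_epi _
  · rintro ⟨hepi, hiso⟩ j hj
    have := hiso (j + 1) (by lia)
    refine (exactAt_mappingCone_iff φ j _ rfl).2 ⟨?_, inferInstance⟩
    obtain rfl | hj := hj.eq_or_lt
    · exact hepi
    · have := hiso j hj
      infer_instance

theorem acyclic_mappingCone_iff {K L : CochainComplex C ℤ} (φ : K ⟶ L) :
    (mappingCone φ).Acyclic ↔ QuasiIso φ := by
  refine ⟨fun h => ⟨fun n => ?_⟩, fun h n => ?_⟩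
  · rw [quasiIsoAt_iff_isIso_homologyMap]
    exact ((forall_exactAt_mappingCone_iff φ (n - 1)).1 fun j _ => h j).2 n (by lia)
  · exact (forall_exactAt_mappingCone_iff φ n).2
      ⟨inferInstance, fun _ _ => inferInstance⟩ n le_rfl

theorem exactAt_mappingCone_iff_of_isZero {C : Type*} [Category* C] [Abelian C]
    {K L : CochainComplex C ℤ} (φ : K ⟶ L) (hK : ∀ i, IsZero (K.X i)) (i : ℤ) :
    (mappingCone φ).ExactAt i ↔ L.ExactAt i := by
  have (n : ℤ) : IsIso ((mappingCone.inr φ).f n) := by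
    refine ⟨(mappingCone.snd φ).v n n (add_zero n), by simp, ?_⟩
    rw [← mappingCone.id_X φ n (n + 1) rfl,
      (hK (n + 1)).eq_zero_of_tgt ((mappingCone.fst φ).1.v n (n + 1) rfl), zero_comp, zero_add]
  have := Hom.isIso_of_components (mappingCone.inr φ)
  exact (exactAt_iff_of_iso (asIso (mappingCone.inr φ)) i).symm

theorem projective_mappingCone_X {C : Type*} [Category* C] [Abelian C]
    {P Q : CochainComplex C ℤ} (f : P ⟶ Q) [∀ i, Projective (P.X i)]
    [∀ i, Projective (Q.X i)] (i : ℤ) : Projective ((mappingCone f).X i) :=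
  Projective.of_iso (homotopyCofiber.XIsoBiprod f i (i + 1) rfl).symm inferInstance

theorem isBoundedAbove_mappingCone {P K : CochainComplex C ℤ} (f : P ⟶ K)
    (hP : IsBoundedAbove P) (hK : IsBoundedAbove K) : IsBoundedAbove (mappingCone f) := by
  obtain ⟨m, hm⟩ := hP
  obtain ⟨n, hn⟩ := hK
  refine ⟨max m n, (isStrictlyLE_iff _ _).2 fun i hi => ?_⟩
  rw [IsZero.iff_id_eq_zero, ← mappingCone.id_X f i (i + 1) rfl,
    (P.isZero_of_isStrictlyLE m (i + 1) (by lia)).eq_zero_of_tgt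
      ((mappingCone.fst f).1.v i (i + 1) rfl),
    (K.isZero_of_isStrictlyLE n i (by lia)).eq_zero_of_tgt
      ((mappingCone.snd f).v i i (add_zero i)), zero_comp, zero_comp, add_zero]

/-- The given sequence splits into two short exact ones; as `D` is acyclic, the connecting maps
identify `H^{j₀} F` and `H^{j₂} T` with the same homology of the image of `α`. -/
theorem exactAt_iff_of_exact {T G D F : CochainComplex C ℤ} (θ : T ⟶ G) (α : G ⟶ D) (β : D ⟶ F)
    (w₁ : θ ≫ α = 0) (w₂ : α ≫ β = 0) [Mono θ] (h₁ : (ShortComplex.mk θ α w₁).Exact)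
    (h₂ : (ShortComplex.mk α β w₂).Exact) [Epi β] (hD : D.Acyclic) (j₀ j₁ j₂ : ℤ)
    (h₀₁ : j₀ + 1 = j₁) (h₁₂ : j₁ + 1 = j₂) (hG₁ : G.ExactAt j₁) (hG₂ : G.ExactAt j₂) :
    F.ExactAt j₀ ↔ T.ExactAt j₂ := by
  have hα : Epi (kernel.lift β α w₂) := (ShortComplex.exact_iff_epi_kernel_lift _).1 h₂
  have w₀ : θ ≫ kernel.lift β α w₂ = 0 := by
    rw [← cancel_mono (kernel.ι β), Category.assoc, kernel.lift_ι, w₁, zero_comp]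
  have hS : (ShortComplex.mk θ (kernel.lift β α w₂) w₀).ShortExact :=
    { exact := by
        let φ : ShortComplex.mk θ (kernel.lift β α w₂) w₀ ⟶ ShortComplex.mk θ α w₁ :=
          { τ₁ := 𝟙 _, τ₂ := 𝟙 _, τ₃ := kernel.ι β }
        have : Epi φ.τ₁ := inferInstanceAs (Epi (𝟙 T))
        have : IsIso φ.τ₂ := inferInstanceAs (IsIso (𝟙 G))
        have : Mono φ.τ₃ := inferInstanceAs (Mono (kernel.ι β))
        exact (ShortComplex.exact_iff_of_epi_of_isIso_of_mono φ).2 h₁ }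
  have hS' : (ShortComplex.mk (kernel.ι β) β (kernel.condition β)).ShortExact :=
    { exact := ShortComplex.exact_kernel β }
  have e := hS.δIso j₁ j₂ h₁₂ hG₁.isZero_homology hG₂.isZero_homology
  have e' := hS'.δIso j₀ j₁ h₀₁ (hD j₀).isZero_homology (hD j₁).isZero_homology
  rw [exactAt_iff_isZero_homology, exactAt_iff_isZero_homology]
  exact e'.isZero_iff.trans e.isZero_iff

end Homology

section ExactFunctor

variable {C D : Type*} [Category* C] [Category* D] [Abelian C] [Abelian D] {ι : Type*}
  {c : ComplexShape ι} (F : C ⥤ D) [F.Additive]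

theorem exactAt_map {K : HomologicalComplex C c} {i : ι} (h : K.ExactAt i)
    [PreservesFiniteLimits F] [PreservesFiniteColimits F] :
    ((F.mapHomologicalComplex c).obj K).ExactAt i :=
  ShortComplex.Exact.map h F

theorem exactAt_map_iff (K : HomologicalComplex C c) (i : ι)
    [PreservesFiniteLimits F] [PreservesFiniteColimits F] [F.Faithful] :
    ((F.mapHomologicalComplex c).obj K).ExactAt i ↔ K.ExactAt i :=
  ShortComplex.exact_map_iff_of_faithful (K.sc i) F

theorem exactAt_map_mappingCone_iff {P K : CochainComplex C ℤ} (f : P ⟶ K)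
    (hP : ∀ i, IsZero (F.obj (P.X i))) (i : ℤ) :
    ((F.mapHomologicalComplex _).obj (mappingCone f)).ExactAt i ↔
      ((F.mapHomologicalComplex _).obj K).ExactAt i :=
  (exactAt_iff_of_iso (mappingCone.mapHomologicalComplexIso f F) i).trans
    (exactAt_mappingCone_iff_of_isZero _ hP i)

end ExactFunctor

section DerivedIso

variable {C : Type u} [Category.{v} C] [Abelian C] {K L M : CochainComplex C ℤ}

attribute [local instance] HasDerivedCategory.standard in
theorem DerivedIso.of_quasiIso (φ : K ⟶ L) [QuasiIso φ] : DerivedIso K L :=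
  ⟨asIso (DerivedCategory.Q.map φ)⟩

theorem DerivedIso.symm (h : DerivedIso K L) : DerivedIso L K :=
  ⟨h.some.symm⟩

theorem DerivedIso.trans (h : DerivedIso K L) (h' : DerivedIso L M) : DerivedIso K M :=
  ⟨h.some ≪≫ h'.some⟩

theorem DerivedIso.of_homotopyEquiv (e : HomotopyEquiv K L) : DerivedIso K L :=
  have := e.quasiIso_hom
  .of_quasiIso e.hom

attribute [local instance] HasDerivedCategory.standard in
theorem DerivedIso.nonempty_homotopyEquiv [K.IsKProjective] [L.IsKProjective]
    (h : DerivedIso K L) : Nonempty (HomotopyEquiv K L) := by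
  obtain ⟨e⟩ := h
  let Qh (X Y : CochainComplex C ℤ) [X.IsKProjective] :=
    IsKProjective.Qh_map_bijective X ((HomotopyCategory.quotient _ _).obj Y)
  let ε := DerivedCategory.quotientCompQhIso C
  obtain ⟨g, hg⟩ := (Qh K L).surjective (ε.hom.app K ≫ e.hom ≫ ε.inv.app L)
  obtain ⟨g', hg'⟩ := (Qh L K).surjective (ε.hom.app L ≫ e.inv ≫ ε.inv.app K)
  refine ⟨HomotopyCategory.homotopyEquivOfIso ⟨g, g', (Qh K K).injective ?_,
    (Qh L L).injective ?_⟩⟩ <;>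
  simp [hg, hg', ε]

theorem IsBoundedAbove.isKProjective {P : CochainComplex C ℤ} (hP : IsBoundedAbove P)
    [∀ i, Projective (P.X i)] : P.IsKProjective := by
  obtain ⟨m, hm⟩ := hP
  exact isKProjective_of_projective P m

theorem ProjRes.isKProjective (R : ProjRes K) : R.P.IsKProjective :=
  have := R.projective
  R.boundedAbove.isKProjective

theorem ProjRes.derivedIso (R : ProjRes K) : DerivedIso R.P K :=
  have := R.quasiIso
  .of_quasiIso R.f

end DerivedIso

section LeftDerived

variable {C D : Type*} [Category* C] [Category* D] [Abelian C] [Abelian D]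

instance (F : C ⥤ D) [F.Additive] [HasProjectiveResolutions C] (n : ℕ) :
    (F.leftDerived n).Additive where
  map_add {X Y f g} := by
    let P := projectiveResolution X
    let Q := projectiveResolution Y
    have map_eq (h : X ⟶ Y) (φ : P.complex ⟶ Q.complex)
        (w : φ ≫ Q.π = P.π ≫ (ChainComplex.single₀ C).map h) :=
      F.leftDerived_map_eq n h φ w
    rw [map_eq f (ProjectiveResolution.lift f P Q) (by simp),
      map_eq g (ProjectiveResolution.lift g P Q) (by simp),
      map_eq (f + g) (ProjectiveResolution.lift f P Q + ProjectiveResolution.lift g P Q)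
        (by simp), Functor.map_add, Preadditive.add_comp, Preadditive.comp_add]

variable {F₁ F₂ F₃ : C ⥤ D} [F₁.Additive] [F₂.Additive]
  {α : F₁ ⟶ F₂} {β : F₂ ⟶ F₃} {w : α ≫ β = 0}

/-- The sequence of functors `F₁ ⟶ F₂ ⟶ F₃ ⟶ 0` is exact, and its value on every projective
object is a short exact sequence. -/
structure ShortExactOnProjectives (α : F₁ ⟶ F₂) (β : F₂ ⟶ F₃) (w : α ≫ β = 0) : Prop where
  exact (X : C) : (ShortComplex.mk (α.app X) (β.app X) (congr_app w X)).Exact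
  epi (X : C) : Epi (β.app X)
  mono (P : C) [Projective P] : Mono (α.app P)

/-- `L₁F₃ ⟶ F₁ ⟶ F₂` being exact, the content is a snake lemma for the action of `α` on the
presentation `S.X₁ ⟶ S.X₂ ⟶ S.X₃ ⟶ 0`. -/
theorem ShortExactOnProjectives.mono_app_of_exact (h : ShortExactOnProjectives α β w)
    [F₁.PreservesEpimorphisms] [PreservesFiniteColimits F₂]
    {S : ShortComplex C} (hS : S.Exact) [Epi S.g] [Mono (α.app S.X₂)] [Mono (F₃.map S.f)] :
    Mono (α.app S.X₃) := by
  rw [Preadditive.mono_iff_cancel_zero]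
  intro T x hx
  obtain ⟨T₀, p₀, _, x₀, hx₀⟩ := surjective_up_to_refinements_of_epi (F₁.map S.g) x
  have hαx₀ : (x₀ ≫ α.app S.X₂) ≫ F₂.map S.g = 0 := by
    rw [Category.assoc, ← α.naturality, ← reassoc_of% hx₀, hx, comp_zero]
  obtain ⟨T₁, p₁, _, (y : T₁ ⟶ F₂.obj S.X₁), hy⟩ :=
    (hS.map_of_epi_of_preservesCokernel F₂ inferInstance inferInstance).exact_up_to_refinements
      _ hαx₀
  replace hy : p₁ ≫ x₀ ≫ α.app S.X₂ = y ≫ F₂.map S.f := hy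
  have hβy : y ≫ β.app S.X₁ = 0 := by
    rw [← cancel_mono (F₃.map S.f), Category.assoc, ← β.naturality, ← reassoc_of% hy,
      ← NatTrans.comp_app, w, NatTrans.app_zero, comp_zero, comp_zero, zero_comp]
  obtain ⟨T₂, p₂, _, (t : T₂ ⟶ F₁.obj S.X₁), ht⟩ :=
    (h.exact S.X₁).exact_up_to_refinements y hβy
  replace ht : p₂ ≫ y = t ≫ α.app S.X₁ := ht
  have ht₀ : p₂ ≫ p₁ ≫ x₀ = t ≫ F₁.map S.f := by
    simp only [← cancel_mono (α.app S.X₂), Category.assoc, hy, α.naturality, reassoc_of% ht]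
  rw [← cancel_epi (p₂ ≫ p₁ ≫ p₀)]
  simp only [Category.assoc, hx₀, reassoc_of% ht₀, ← F₁.map_comp, S.zero, F₁.map_zero, comp_zero]

variable [F₃.Additive]

variable (α β w) in
/-- The short complex of complexes `F₁ K ⟶ F₂ K ⟶ F₃ K`. -/
def mapShortComplex {ι : Type*} {c : ComplexShape ι} (K : HomologicalComplex C c) :
    ShortComplex (HomologicalComplex D c) where
  X₁ := (F₁.mapHomologicalComplex c).obj K
  X₂ := (F₂.mapHomologicalComplex c).obj K
  X₃ := (F₃.mapHomologicalComplex c).obj K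
  f := (NatTrans.mapHomologicalComplex α c).app K
  g := (NatTrans.mapHomologicalComplex β c).app K
  zero := by
    ext i
    exact congr_app w (K.X i)

variable (α β w) in
/-- The functoriality of `F₁ K ⟶ F₂ K ⟶ F₃ K` in the complex `K`. -/
def mapShortComplexMap {ι : Type*} {c : ComplexShape ι} {K L : HomologicalComplex C c}
    (f : K ⟶ L) : mapShortComplex α β w K ⟶ mapShortComplex α β w L where
  τ₁ := (F₁.mapHomologicalComplex c).map f
  τ₂ := (F₂.mapHomologicalComplex c).map f
  τ₃ := (F₃.mapHomologicalComplex c).map f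
  comm₁₂ := (NatTrans.mapHomologicalComplex α c).naturality f
  comm₂₃ := (NatTrans.mapHomologicalComplex β c).naturality f

namespace ShortExactOnProjectives

variable (h : ShortExactOnProjectives α β w)

include h

theorem shortExact_mapShortComplex {ι : Type*} {c : ComplexShape ι} (K : HomologicalComplex C c)
    [∀ i, Projective (K.X i)] : (mapShortComplex α β w K).ShortExact :=
  shortExact_of_degreewise_shortExact _ fun i =>
    { exact := h.exact (K.X i)
      mono_f := h.mono (K.X i)
      epi_g := h.epi (K.X i) }

end ShortExactOnProjectives

theorem mono_map_fromOpcycles (F : C ⥤ D) [F.Additive] [F.PreservesEpimorphisms]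
    {K : CochainComplex C ℤ} {i j : ℤ} (hij : i + 1 = j)
    (hi : ((F.mapHomologicalComplex _).obj K).ExactAt i) : Mono (F.map (K.fromOpcycles i j)) := by
  rw [Preadditive.mono_iff_cancel_zero]
  intro T x hx
  obtain ⟨T₀, p₀, _, x₀, hx₀⟩ := surjective_up_to_refinements_of_epi (F.map (K.pOpcycles i)) x
  have hdx₀ : x₀ ≫ F.map (K.d i j) = 0 := by
    rw [← K.p_fromOpcycles, F.map_comp, ← reassoc_of% hx₀, hx, comp_zero]
  obtain ⟨T₁, p₁, _, (y : T₁ ⟶ F.obj (K.X (i - 1))), hy⟩ :=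
    ((exactAt_iff' _ (i - 1) i j (by simp) (by simpa)).1 hi).exact_up_to_refinements x₀ hdx₀
  replace hy : p₁ ≫ x₀ = y ≫ F.map (K.d (i - 1) i) := hy
  rw [← cancel_epi (p₁ ≫ p₀)]
  simp only [Category.assoc, hx₀, reassoc_of% hy, ← F.map_comp, d_pOpcycles, F.map_zero, comp_zero]

namespace ShortExactOnProjectives

variable (h : ShortExactOnProjectives α β w)

include h

theorem mono_app_opcycles [F₁.PreservesEpimorphisms] [PreservesFiniteColimits F₂]
    [F₃.PreservesEpimorphisms] {P : CochainComplex C ℤ} [∀ i, Projective (P.X i)] {i j : ℤ}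
    (hij : i + 1 = j) (hi : ((F₃.mapHomologicalComplex _).obj P).ExactAt i) :
    Mono (α.app (P.opcycles j)) := by
  have hd : (ShortComplex.mk (P.d i j) (P.pOpcycles j) (P.d_pOpcycles i j)).Exact :=
    ShortComplex.exact_of_g_is_cokernel _ (P.opcyclesIsCokernel i j (by simp [← hij]))
  have hw : P.fromOpcycles i j ≫ P.pOpcycles j = 0 := by
    rw [← cancel_epi (P.pOpcycles i), p_fromOpcycles_assoc, d_pOpcycles, comp_zero]
  have hS : (ShortComplex.mk (P.fromOpcycles i j) (P.pOpcycles j) hw).Exact := by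
    let φ : ShortComplex.mk (P.d i j) (P.pOpcycles j) (P.d_pOpcycles i j) ⟶
        ShortComplex.mk (P.fromOpcycles i j) (P.pOpcycles j) hw :=
      { τ₁ := P.pOpcycles i, τ₂ := 𝟙 _, τ₃ := 𝟙 _ }
    have : Epi φ.τ₁ := inferInstanceAs (Epi (P.pOpcycles i))
    have : IsIso φ.τ₂ := inferInstanceAs (IsIso (𝟙 (P.X j)))
    have : Mono φ.τ₃ := inferInstanceAs (Mono (𝟙 (P.opcycles j)))
    exact (ShortComplex.exact_iff_of_epi_of_isIso_of_mono φ).1 hd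
  have := h.mono (P.X j)
  have := mono_map_fromOpcycles F₃ hij hi
  exact h.mono_app_of_exact hS

end ShortExactOnProjectives

section Connecting

theorem homologyMap_comp_fromLeftDerivedZero' (α : F₁ ⟶ F₂) {X : C} (P : ProjectiveResolution X) :
    (homologyFunctor D _ 0).map ((NatTrans.mapHomologicalComplex α _).app P.complex) ≫
        (ChainComplex.isoHomologyι₀ _).hom ≫ P.fromLeftDerivedZero' F₂ =
      ((ChainComplex.isoHomologyι₀ _).hom ≫ P.fromLeftDerivedZero' F₁) ≫ α.app X := by
  have hα : opcyclesMap ((NatTrans.mapHomologicalComplex α _).app P.complex) 0 ≫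
      P.fromLeftDerivedZero' F₂ = P.fromLeftDerivedZero' F₁ ≫ α.app X := by
    rw [← cancel_epi (pOpcycles _ _), p_opcyclesMap_assoc,
      ProjectiveResolution.pOpcycles_comp_fromLeftDerivedZero',
      ProjectiveResolution.pOpcycles_comp_fromLeftDerivedZero'_assoc]
    exact (α.naturality _).symm
  rw [Category.assoc, ← hα]
  exact homologyι_naturality_assoc ((NatTrans.mapHomologicalComplex α _).app P.complex) 0 _

namespace ShortExactOnProjectives

variable (h : ShortExactOnProjectives α β w)

variable {ι : Type*} {c : ComplexShape ι} (K : HomologicalComplex C c)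
  [∀ i, Projective (K.X i)] (i j : ι) (hij : c.Rel i j)

/-- The connecting morphism `Hᵢ(F₃ K) ⟶ Hⱼ(F₁ K)` for a complex `K` of projective objects. -/
def homologyδ : (homologyFunctor D c i).obj ((F₃.mapHomologicalComplex c).obj K) ⟶
    (homologyFunctor D c j).obj ((F₁.mapHomologicalComplex c).obj K) :=
  (h.shortExact_mapShortComplex K).δ i j hij

theorem homologyδ_comp : h.homologyδ K i j hij ≫
    (homologyFunctor D c j).map ((NatTrans.mapHomologicalComplex α c).app K) = 0 :=
  (h.shortExact_mapShortComplex K).δ_comp i j hij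

theorem exact_homologyδ : (ShortComplex.mk _ _ (h.homologyδ_comp K i j hij)).Exact :=
  (h.shortExact_mapShortComplex K).homology_exact₁ i j hij

theorem mono_homologyδ (hi : ((F₂.mapHomologicalComplex c).obj K).ExactAt i) :
    Mono (h.homologyδ K i j hij) :=
  (h.shortExact_mapShortComplex K).mono_δ i j hij hi.isZero_homology

variable {K} in
theorem homologyδ_naturality {L : HomologicalComplex C c} [∀ i, Projective (L.X i)] (φ : K ⟶ L) :
    h.homologyδ K i j hij ≫ (homologyFunctor D c j).map ((F₁.mapHomologicalComplex c).map φ) =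
      (homologyFunctor D c i).map ((F₃.mapHomologicalComplex c).map φ) ≫ h.homologyδ L i j hij :=
  HomologySequence.δ_naturality (mapShortComplexMap α β w φ)
    (h.shortExact_mapShortComplex K) (h.shortExact_mapShortComplex L) i j hij

end ShortExactOnProjectives

variable [HasProjectiveResolutions C]

theorem leftDerived_zero_comp_fromLeftDerivedZero (α : F₁ ⟶ F₂) :
    NatTrans.leftDerived α 0 ≫ F₂.fromLeftDerivedZero = F₁.fromLeftDerivedZero ≫ α := by
  ext X
  let P := projectiveResolution X
  rw [NatTrans.comp_app, NatTrans.comp_app, P.leftDerived_app_eq, P.fromLeftDerivedZero_eq,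
    P.fromLeftDerivedZero_eq, Category.assoc, Category.assoc, Iso.inv_hom_id_assoc,
    homologyMap_comp_fromLeftDerivedZero']
  exact (Category.assoc _ _ _).symm

namespace ShortExactOnProjectives

variable (h : ShortExactOnProjectives α β w)

/-- The connecting morphism `Lₙ₊₁F₃ ⟶ LₙF₁`. -/
def leftDerivedδ (n : ℕ) : F₃.leftDerived (n + 1) ⟶ F₁.leftDerived n where
  app X := ((projectiveResolution X).isoLeftDerivedObj F₃ (n + 1)).hom ≫
    h.homologyδ (projectiveResolution X).complex (n + 1) n (by simp) ≫
      ((projectiveResolution X).isoLeftDerivedObj F₁ n).inv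
  naturality X Y f := by
    let φ := ProjectiveResolution.lift f (projectiveResolution X) (projectiveResolution Y)
    have hφ := ProjectiveResolution.lift_commutes_zero f (projectiveResolution X)
      (projectiveResolution Y)
    rw [Category.assoc, Category.assoc,
      ProjectiveResolution.isoLeftDerivedObj_inv_naturality f _ _ φ hφ,
      ProjectiveResolution.isoLeftDerivedObj_hom_naturality_assoc f _ _ φ hφ,
      Functor.comp_map, reassoc_of% h.homologyδ_naturality (n + 1) n (by simp) φ]

theorem leftDerivedδ_comp (n : ℕ) : h.leftDerivedδ n ≫ NatTrans.leftDerived α n = 0 := by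
  ext X
  rw [NatTrans.comp_app, (projectiveResolution X).leftDerived_app_eq, leftDerivedδ,
    Category.assoc, Category.assoc, Iso.inv_hom_id_assoc, reassoc_of% h.homologyδ_comp, zero_comp,
    comp_zero, NatTrans.app_zero]

theorem exact_leftDerivedδ_app (n : ℕ) (X : C) :
    (ShortComplex.mk _ _ (congr_app (h.leftDerivedδ_comp n) X)).Exact := by
  let P := projectiveResolution X
  refine ShortComplex.exact_of_iso ?_ (h.exact_homologyδ P.complex (n + 1) n (by simp))
  refine ShortComplex.isoMk (P.isoLeftDerivedObj F₃ (n + 1)).symm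
    (P.isoLeftDerivedObj F₁ n).symm (P.isoLeftDerivedObj F₂ n).symm ?_ ?_
  · simp [leftDerivedδ, P]
  · simp [P.leftDerived_app_eq]

theorem mono_leftDerivedδ_app [PreservesFiniteLimits F₂] [PreservesFiniteColimits F₂] (n : ℕ)
    (X : C) : Mono ((h.leftDerivedδ n).app X) :=
  have := h.mono_homologyδ (projectiveResolution X).complex (n + 1) n (by simp)
    (exactAt_map F₂ ((projectiveResolution X).complex_exactAt_succ n))
  mono_comp _ (_ ≫ _)

/-- The connecting morphism `L₁F₃ ⟶ F₁`. -/
def connectingHom : F₃.leftDerived 1 ⟶ F₁ := h.leftDerivedδ 0 ≫ F₁.fromLeftDerivedZero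

theorem connectingHom_comp : h.connectingHom ≫ α = 0 := by
  rw [connectingHom, Category.assoc, ← leftDerived_zero_comp_fromLeftDerivedZero,
    reassoc_of% h.leftDerivedδ_comp 0, zero_comp]

variable [PreservesFiniteColimits F₁] [PreservesFiniteColimits F₂]

theorem exact_connectingHom_app (X : C) :
    (ShortComplex.mk _ _ (congr_app h.connectingHom_comp X)).Exact := by
  refine ShortComplex.exact_of_iso ?_ (h.exact_leftDerivedδ_app 0 X)
  exact ShortComplex.isoMk (Iso.refl _) (asIso (F₁.fromLeftDerivedZero.app X))
    (asIso (F₂.fromLeftDerivedZero.app X)) (by simp [connectingHom])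
    (congr_app (leftDerived_zero_comp_fromLeftDerivedZero α) X).symm

theorem mono_connectingHom_app [PreservesFiniteLimits F₂] (X : C) :
    Mono (h.connectingHom.app X) :=
  have := h.mono_leftDerivedδ_app 0 X
  inferInstanceAs (Mono ((h.leftDerivedδ 0).app X ≫ F₁.fromLeftDerivedZero.app X))

include h in
theorem isZero_leftDerived_one_obj [PreservesFiniteLimits F₂] (X : C) [Mono (α.app X)] :
    IsZero ((F₃.leftDerived 1).obj X) := by
  have := h.mono_connectingHom_app X
  have hα : h.connectingHom.app X ≫ α.app X = 0 := congr_app h.connectingHom_comp X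
  exact .of_mono_eq_zero _ (zero_of_comp_mono _ hα)

end ShortExactOnProjectives

end Connecting

end LeftDerived

/-- The ideal of the morphisms annihilated by `F` has square zero. -/
def HasSquareZeroKernel {C D : Type*} [Category* C] [Category* D] [HasZeroMorphisms C]
    [HasZeroMorphisms D] (F : C ⥤ D) : Prop :=
  ∀ ⦃X Y Z : C⦄ (f : X ⟶ Y) (g : Y ⟶ Z), F.map f = 0 → F.map g = 0 → f ≫ g = 0

section SquareZero

variable {C D : Type*} [Category* C] [Category* D] [Abelian C] [Abelian D]
  {F G : C ⥤ D} {S : D ⥤ D} [G.Additive] [S.Additive] {α : F ⋙ S ⟶ G} {β : G ⟶ F}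
  {w : α ≫ β = 0}

namespace ShortExactOnProjectives

variable (h : ShortExactOnProjectives α β w)

include h

theorem hasSquareZeroKernel [G.Faithful] : HasSquareZeroKernel F := by
  intro X Y Z f g hf hg
  apply G.map_injective
  have hfβ : G.map f ≫ β.app Y = 0 := by rw [β.naturality, hf, comp_zero]
  obtain ⟨T, p, _, (x : T ⟶ S.obj (F.obj Y)), hx⟩ := (h.exact Y).exact_up_to_refinements _ hfβ
  replace hx : p ≫ G.map f = x ≫ α.app Y := hx
  rw [← cancel_epi p, G.map_comp, reassoc_of% hx, ← α.naturality, Functor.comp_map, hg,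
    S.map_zero, zero_comp, comp_zero, G.map_zero, comp_zero]

variable [F.Additive] [PreservesFiniteColimits G] [PreservesFiniteLimits G]
  [PreservesFiniteColimits S] [PreservesFiniteLimits S]

theorem exactAt_of_exactAt_map [G.Faithful] {ι : Type*} {c : ComplexShape ι}
    {K : HomologicalComplex C c} [∀ i, Projective (K.X i)] {i : ι}
    (hi : ((F.mapHomologicalComplex c).obj K).ExactAt i) : K.ExactAt i :=
  (exactAt_map_iff G K i).1
    ((h.shortExact_mapShortComplex K).exactAt_X₂ i (exactAt_map S hi) hi)

theorem quasiIso_of_quasiIso_map [G.Faithful] {P Q : CochainComplex C ℤ}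
    [∀ i, Projective (P.X i)] [∀ i, Projective (Q.X i)] (f : P ⟶ Q)
    [QuasiIso ((F.mapHomologicalComplex _).map f)] : QuasiIso f := by
  refine (acyclic_mappingCone_iff f).1 fun i => ?_
  have := projective_mappingCone_X f
  exact h.exactAt_of_exactAt_map
    ((exactAt_iff_of_iso (mappingCone.mapHomologicalComplexIso f F) i).2
      ((acyclic_mappingCone_iff _).2 inferInstance i))

variable [PreservesFiniteColimits F] [HasProjectiveResolutions C]

theorem exactAt_map_iff_exactAt_leftDerived_one {K : CochainComplex C ℤ} (hK : K.Acyclic)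
    (j₀ j₁ j₂ : ℤ) (h₀₁ : j₀ + 1 = j₁) (h₁₂ : j₁ + 1 = j₂)
    (hj₁ : ((F.mapHomologicalComplex _).obj K).ExactAt j₁)
    (hj₂ : ((F.mapHomologicalComplex _).obj K).ExactAt j₂) :
    ((F.mapHomologicalComplex _).obj K).ExactAt j₀ ↔
      (((F.leftDerived 1).mapHomologicalComplex _).obj K).ExactAt j₂ := by
  let θ := (NatTrans.mapHomologicalComplex h.connectingHom (.up ℤ)).app K
  have : Mono θ := mono_of_mono_f _ fun i => h.mono_connectingHom_app (K.X i)
  have : Epi (mapShortComplex α β w K).g := epi_of_epi_f _ fun i => h.epi (K.X i)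
  have w₁ : θ ≫ (mapShortComplex α β w K).f = 0 := by
    ext i
    exact congr_app h.connectingHom_comp (K.X i)
  exact exactAt_iff_of_exact θ _ _ w₁ (mapShortComplex α β w K).zero
    (exact_of_degreewise_exact _ fun i => h.exact_connectingHom_app (K.X i))
    (exact_of_degreewise_exact _ fun i => h.exact (K.X i))
    (fun i => exactAt_map G (hK i)) j₀ j₁ j₂ h₀₁ h₁₂ (exactAt_map S hj₁) (exactAt_map S hj₂)

theorem forall_exactAt_map_iff {K : CochainComplex C ℤ} (hK : K.Acyclic)
    (hK' : IsBoundedAbove K) (a : ℤ) :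
    (∀ j, a ≤ j → ((F.mapHomologicalComplex _).obj K).ExactAt j) ↔
      ∀ j, a ≤ j → (((F.leftDerived 1).mapHomologicalComplex _).obj K).ExactAt (j + 2) := by
  have step (j : ℤ) := h.exactAt_map_iff_exactAt_leftDerived_one hK j (j + 1) (j + 2) rfl (by lia)
  refine ⟨fun H j hj => (step j (H _ (by lia)) (H _ (by lia))).1 (H j hj), fun H => ?_⟩
  obtain ⟨m, hm⟩ := hK'
  have descend (n : ℕ) : ∀ j, a ≤ j → m + 1 - n ≤ j →
      ((F.mapHomologicalComplex _).obj K).ExactAt j := by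
    induction n with
    | zero =>
      intro j _ hj
      exact .of_isZero (F.map_isZero (K.isZero_of_isStrictlyLE m j (by lia)))
    | succ n ih =>
      intro j hj hj'
      exact (step j (ih _ (by lia) (by lia)) (ih _ (by lia) (by lia))).2 (H j hj)
  exact fun j hj => descend (m + 1 - j).toNat j hj (by lia)

theorem forall_exactAt_mappingCone_map_iff {P K : CochainComplex C ℤ} (f : P ⟶ K) [QuasiIso f]
    [∀ i, Projective (P.X i)] (hP : IsBoundedAbove P) (hK : IsBoundedAbove K) (a : ℤ) :
    (∀ j, a ≤ j → (mappingCone ((F.mapHomologicalComplex _).map f)).ExactAt j) ↔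
      ∀ j, a ≤ j → (((F.leftDerived 1).mapHomologicalComplex _).obj K).ExactAt (j + 2) := by
  have hL₁ := exactAt_map_mappingCone_iff (F.leftDerived 1) f
    fun i => F.isZero_leftDerived_obj_projective_succ 0 (P.X i)
  have hF := exactAt_iff_of_iso (mappingCone.mapHomologicalComplexIso f F)
  simp only [← hL₁, ← hF]
  exact h.forall_exactAt_map_iff ((acyclic_mappingCone_iff f).2 inferInstance)
    (isBoundedAbove_mappingCone f hP hK) a

end ShortExactOnProjectives

end SquareZero

section Perturbation

variable {C D : Type*} [Category* C] [Category* D] [Preadditive C] [Preadditive D]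
  {F : C ⥤ D}

theorem HasSquareZeroKernel.comp_eq_comp [F.Additive] (hF : HasSquareZeroKernel F) {X Y Z : C}
    {f : X ⟶ Y} {g g' : Y ⟶ Z} (hf : F.map f = 0) (hg : F.map g = F.map g') : f ≫ g = f ≫ g' := by
  rw [← sub_eq_zero, ← Preadditive.comp_sub]
  exact hF _ _ hf (by rw [F.map_sub, hg, sub_self])

variable {ι : Type*} {c : ComplexShape ι} (P Q : HomologicalComplex C c)

/-- The failure of a family of morphisms `Q.X i ⟶ P.X i` to be a morphism of complexes. -/
def defect (g : ∀ i, Q.X i ⟶ P.X i) (i j : ι) : Q.X i ⟶ P.X j :=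
  g i ≫ P.d i j - Q.d i j ≫ g j

variable {P Q}

theorem defect_eq_zero (g : ∀ i, Q.X i ⟶ P.X i) {i j : ι} (h : ¬ c.Rel i j) :
    defect P Q g i j = 0 := by
  rw [defect, P.shape _ _ h, Q.shape _ _ h, comp_zero, zero_comp, sub_zero]

theorem defect_comp_d (g : ∀ i, Q.X i ⟶ P.X i) (i j k : ι) :
    defect P Q g i j ≫ P.d j k = -(Q.d i j ≫ defect P Q g j k) := by
  simp [defect]

variable (hF : HasSquareZeroKernel F) (g : ∀ i, Q.X i ⟶ P.X i)
  (hg : ∀ i j, F.map (defect P Q g i j) = 0) (f : ∀ i, P.X i ⟶ Q.X i)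
  (hf : ∀ i j, F.map (f i ≫ Q.d i j) = F.map (P.d i j ≫ f j))

include hF hg in
theorem defect_comp_comp_defect (i j k : ι) :
    defect P Q g i j ≫ f j ≫ defect P Q g j k = 0 :=
  hF _ _ (hg i j) (by rw [F.map_comp, hg, comp_zero])

variable [F.Additive]

/-- The complex `Q` with its differential corrected by the defect of `g` followed by `f`. If `f`
and `g` become morphisms of complexes after application of `F`, the correction is invisible to
`F`. -/
def deform : HomologicalComplex C c where
  X := Q.X
  d i j := Q.d i j + defect P Q g i j ≫ f j
  shape i j h := by rw [defect_eq_zero g h, Q.shape i j h, zero_comp, add_zero]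
  d_comp_d' i j k _ _ := by
    have hfd : defect P Q g i j ≫ f j ≫ Q.d j k = -(Q.d i j ≫ defect P Q g j k ≫ f k) := by
      rw [hF.comp_eq_comp (hg i j) (hf j k), reassoc_of% defect_comp_d g i j k,
        Preadditive.neg_comp, Category.assoc]
    simp [hfd, reassoc_of% defect_comp_comp_defect hF g hg f]

variable (s : ∀ i j, P.X i ⟶ P.X j)
  (hs : ∀ i j, c.Rel i j → F.map (f j ≫ g j) =
    F.map (P.d j (c.next j) ≫ s (c.next j) j + s j i ≫ P.d i j + 𝟙 (P.X j)))

/-- The family `g` corrected by its defect followed by `s`. If `s` becomes a homotopy from `f ≫ g`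
to the identity after application of `F`, this is a morphism from the deformation of `Q`. -/
def deformHom : deform hF g hg f hf ⟶ P where
  f i := g i + defect P Q g i (c.next i) ≫ s (c.next i) i
  comm' i j hij := by
    have hfg : defect P Q g i j ≫ f j ≫ g j =
        -(Q.d i j ≫ defect P Q g j (c.next j) ≫ s (c.next j) j) +
          defect P Q g i j ≫ s j i ≫ P.d i j + defect P Q g i j := by
      rw [hF.comp_eq_comp (hg i j) (hs i j hij)]
      simp [reassoc_of% defect_comp_d g]
    have hgd : g i ≫ P.d i j = Q.d i j ≫ g j + defect P Q g i j := by
      simp [defect]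
    obtain rfl := c.next_eq' hij
    have comm : (g i + defect P Q g i (c.next i) ≫ s (c.next i) i) ≫ P.d i (c.next i) =
        (Q.d i (c.next i) + defect P Q g i (c.next i) ≫ f (c.next i)) ≫
          (g (c.next i) + defect P Q g (c.next i) (c.next (c.next i)) ≫ s _ _) := by
      simp only [Preadditive.add_comp, Preadditive.comp_add, Category.assoc, hgd, hfg,
        reassoc_of% defect_comp_comp_defect hF g hg f, zero_comp, add_zero]
      abel
    exact comm

theorem exists_lift_of_homotopyEquiv (hF : HasSquareZeroKernel F)
    (hP : ∀ i Y, Function.Surjective (F.map : (P.X i ⟶ Y) → _))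
    (hQ : ∀ i Y, Function.Surjective (F.map : (Q.X i ⟶ Y) → _))
    (e : HomotopyEquiv ((F.mapHomologicalComplex c).obj P) ((F.mapHomologicalComplex c).obj Q)) :
    ∃ (Q' : HomologicalComplex C c) (_ : ∀ i, Nonempty (Q'.X i ≅ Q.X i)) (g : Q' ⟶ P)
      (φ : (F.mapHomologicalComplex c).obj Q' ≅ (F.mapHomologicalComplex c).obj Q),
      (F.mapHomologicalComplex c).map g = φ.hom ≫ e.inv := by
  choose g hg' using fun i => hQ i _ (e.inv.f i)
  choose f hf' using fun i => hP i _ (e.hom.f i)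
  choose s hs' using fun i j => hP i _ (e.homotopyHomInvId.hom i j)
  have hg (i j : ι) : F.map (defect P Q g i j) = 0 := by
    rw [defect, F.map_sub, F.map_comp, F.map_comp, hg', hg', sub_eq_zero]
    exact e.inv.comm i j
  have hf (i j : ι) : F.map (f i ≫ Q.d i j) = F.map (P.d i j ≫ f j) := by
    rw [F.map_comp, F.map_comp, hf', hf']
    exact e.hom.comm i j
  have hs (i j : ι) (hij : c.Rel i j) : F.map (f j ≫ g j) =
      F.map (P.d j (c.next j) ≫ s (c.next j) j + s j i ≫ P.d i j + 𝟙 (P.X j)) := by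
    have h := e.homotopyHomInvId.comm j
    rw [prevD_eq _ hij] at h
    simp only [F.map_comp, F.map_add, hf', hg', hs', F.map_id]
    exact h
  refine ⟨deform hF g hg f hf, fun i => ⟨Iso.refl _⟩, deformHom hF g hg f hf s hs,
    Hom.isoOfComponents (fun i => Iso.refl _) fun i j _ => ?_, ?_⟩
  · have hd : F.map (Q.d i j + defect P Q g i j ≫ f j) = F.map (Q.d i j) := by
      rw [F.map_add, F.map_comp, hg, zero_comp, add_zero]
    exact (Category.id_comp _).trans (hd.symm.trans (Category.comp_id _).symm)
  · ext i
    have hgs : F.map (g i + defect P Q g i (c.next i) ≫ s (c.next i) i) = e.inv.f i := by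
      rw [F.map_add, F.map_comp, hg, zero_comp, add_zero, hg']
    exact hgs.trans (Category.id_comp _).symm

end Perturbation

section BaseChange

open TensorProduct

variable {A B : Type u} [CommRing A] [CommRing B] (π : B →+* A)

instance : PreservesFiniteColimits (baseChange π) :=
  have : PreservesColimitsOfSize.{0, 0} (baseChange π) :=
    (ModuleCat.extendRestrictScalarsAdj.{u} π).leftAdjoint_preservesColimits
  PreservesColimitsOfSize.preservesFiniteColimits (baseChange π)

instance (V : ModuleCat.{u} B) [Projective V] : Projective ((baseChange π).obj V) :=
  (ModuleCat.extendRestrictScalarsAdj.{u} π).map_projective V inferInstance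

instance (V : ModuleCat.{u} B) [Module.Finite B V] : Module.Finite A ((baseChange π).obj V) :=
  let := π.toAlgebra
  inferInstanceAs (Module.Finite A (A ⊗[B] V))

instance (K : CochainComplex (ModuleCat.{u} B) ℤ) (i : ℤ) [Projective (K.X i)] :
    Projective (((pullback π).obj K).X i) :=
  inferInstanceAs (Projective ((baseChange π).obj (K.X i)))

theorem pullback_isBoundedAbove {K : CochainComplex (ModuleCat.{u} B) ℤ} (h : IsBoundedAbove K) :
    IsBoundedAbove ((pullback π).obj K) := by
  obtain ⟨m, hm⟩ := h
  exact ⟨m, (isStrictlyLE_iff _ _).2 fun i hi =>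
    (baseChange π).map_isZero (K.isZero_of_isStrictlyLE m i hi)⟩

theorem pullback_isBoundedBelow {K : CochainComplex (ModuleCat.{u} B) ℤ} (h : IsBoundedBelow K) :
    IsBoundedBelow ((pullback π).obj K) := by
  obtain ⟨m, hm⟩ := h
  exact ⟨m, (isStrictlyGE_iff _ _).2 fun i hi =>
    (baseChange π).map_isZero (K.isZero_of_isStrictlyGE m i hi)⟩

/-- The isomorphism `A ⊗_B (B ⊗_A V) ≅ V` when `B` is an `A`-algebra through a section of `π`. -/
def baseChangeSectionIso (σ : A →+* B) (h : π.comp σ = RingHom.id A) :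
    baseChange σ ⋙ baseChange π ≅ 𝟭 (ModuleCat.{u} A) :=
  (ModuleCat.extendScalarsComp.{u} σ π).symm ≪≫ eqToIso (by rw [h]) ≪≫ ModuleCat.extendScalarsId A

/-- The isomorphism `(K ⊗_A B) ⊗_B A ≅ K` of complexes for a section of `π`. -/
def pullbackSectionIso (σ : A →+* B) (h : π.comp σ = RingHom.id A)
    (K : CochainComplex (ModuleCat.{u} A) ℤ) : (pullback π).obj ((pullback σ).obj K) ≅ K :=
  Hom.isoOfComponents (fun i => (baseChangeSectionIso π σ h).app (K.X i))
    fun i j _ => ((baseChangeSectionIso π σ h).hom.naturality (K.d i j)).symm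

/-- The unit `v ↦ 1 ⊗ v` of the base change. -/
def oneTmul (V : ModuleCat.{u} B) : V →ₛₗ[π] (baseChange π).obj V where
  toFun v := (ModuleCat.extendRestrictScalarsAdj.{u} π).unit.app V v
  map_add' := map_add ((ModuleCat.extendRestrictScalarsAdj.{u} π).unit.app V).hom
  map_smul' := map_smul ((ModuleCat.extendRestrictScalarsAdj.{u} π).unit.app V).hom

variable {π}

/-- The linear map on the base change induced by a semilinear map. -/
def baseChangeLift {V : ModuleCat.{u} B} {N : ModuleCat.{u} A} (f : V →ₛₗ[π] N) :
    (baseChange π).obj V ⟶ N :=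
  ((ModuleCat.extendRestrictScalarsAdj.{u} π).homEquiv V N).symm
    (ModuleCat.ofHom (Y := (ModuleCat.restrictScalars π).obj N)
      { toFun := f, map_add' := map_add f, map_smul' := map_smulₛₗ f })

theorem baseChangeLift_oneTmul {V : ModuleCat.{u} B} {N : ModuleCat.{u} A} (f : V →ₛₗ[π] N)
    (v : V) : baseChangeLift f (oneTmul π V v) = f v :=
  ConcreteCategory.congr_hom
    (((ModuleCat.extendRestrictScalarsAdj.{u} π).homEquiv V N).apply_symm_apply _) v

theorem oneTmul_surjective (hπ : Function.Surjective π) (V : ModuleCat.{u} B) :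
    Function.Surjective (oneTmul π V) := by
  intro x
  induction x using TensorProduct.induction_on with
  | zero => exact ⟨0, map_zero _⟩
  | tmul a v =>
    obtain ⟨b, rfl⟩ := hπ a
    refine ⟨b • v, (map_smulₛₗ (oneTmul π V) b v).trans ?_⟩
    exact congrArg (· ⊗ₜ[B] v) (mul_one (π b))
  | add x y hx hy =>
    obtain ⟨v, rfl⟩ := hx
    obtain ⟨v', rfl⟩ := hy
    exact ⟨v + v', map_add _ v v'⟩

theorem baseChange_map_surjective (hπ : Function.Surjective π) (V W : ModuleCat.{u} B)
    [Projective V] : Function.Surjective ((baseChange π).map : (V ⟶ W) → _) := by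
  intro f
  let adj := ModuleCat.extendRestrictScalarsAdj.{u} π
  let η : W ⟶ (ModuleCat.restrictScalars π).obj ((baseChange π).obj W) := adj.unit.app W
  have : Epi η := (ModuleCat.epi_iff_surjective _).2 (oneTmul_surjective hπ W)
  obtain ⟨g, hg⟩ := Projective.factors (adj.homEquiv V ((baseChange π).obj W) f) η
  refine ⟨g, (adj.homEquiv V _).injective (Eq.trans ?_ hg)⟩
  exact (adj.homEquiv_unit ..).trans (adj.unit.naturality g).symm

end BaseChange

/-- A square-zero extension `0 → I → B → A → 0` of commutative rings, together with a section
of `B → A`. By `smul_eq` the ring `B` acts on `I` through `π`, so that `I` has square zero. -/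
structure SplitExtension (A B : Type u) (I : Type w) [CommRing A] [CommRing B] [AddCommGroup I]
    [Module A I] where
  /-- the inclusion of the ideal -/
  ι : I →+ B
  /-- the projection -/
  π : B →+* A
  /-- the section -/
  σ : A →+* B
  ι_injective : Function.Injective ι
  exact : Function.Exact ι π
  smul_eq : ∀ (b : B) (i : I), ι (π b • i) = b * ι i
  π_σ : π.comp σ = RingHom.id A

namespace SplitExtension

section Multiplication

open MonoidalCategory TensorProduct

variable {A B I : Type u} [CommRing A] [CommRing B] [AddCommGroup I] [Module A I]
  (E : SplitExtension A B I)

/-- The restriction of scalars along the section. -/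
abbrev res : ModuleCat.{u} B ⥤ ModuleCat.{u} A := ModuleCat.restrictScalars.{u} E.σ

/-- The functor `V ↦ I ⊗_A (A ⊗_B V)`. -/
abbrev baseChangeTensor : ModuleCat.{u} B ⥤ ModuleCat.{u} A :=
  baseChange E.π ⋙ tensorLeft (ModuleCat.of A I)

theorem π_σ_apply (a : A) : E.π (E.σ a) = a := DFunLike.congr_fun E.π_σ a

theorem π_surjective : Function.Surjective E.π := fun a => ⟨E.σ a, E.π_σ_apply a⟩

theorem ι_smul (a : A) (i : I) : E.ι (a • i) = E.σ a * E.ι i := by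
  rw [← E.smul_eq, E.π_σ_apply]

/-- The multiplication `v ↦ (i ↦ ι i • v)`. -/
def mulHom (V : ModuleCat.{u} B) : V →ₛₗ[E.π] (I →ₗ[A] E.res.obj V) where
  toFun v :=
    { toFun i := (E.ι i • v : V)
      map_add' i j := (congrArg (· • v) (map_add E.ι i j)).trans (add_smul _ _ v)
      map_smul' a i := (congrArg (· • v) (E.ι_smul a i)).trans (mul_smul _ _ v) }
  map_add' v v' := by
    ext i
    exact smul_add (A := V) (E.ι i) v v'
  map_smul' b v := by
    ext i
    change E.ι i • b • v = E.σ (E.π b) • E.ι i • v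
    rw [← mul_smul, ← mul_smul, ← E.ι_smul, E.smul_eq, mul_comm]

/-- The multiplication `I ⊗_A (A ⊗_B V) ⟶ V`. -/
def αApp (V : ModuleCat.{u} B) : E.baseChangeTensor.obj V ⟶ E.res.obj V :=
  ModuleCat.ofHom (X := ModuleCat.of A (I ⊗[A] (baseChange E.π).obj V)) (Y := E.res.obj V)
    (TensorProduct.lift
      (baseChangeLift (N := ModuleCat.of A (I →ₗ[A] E.res.obj V)) (E.mulHom V)).hom.flip)

theorem αApp_tmul (V : ModuleCat.{u} B) (i : I) (v : V) :
    E.αApp V (i ⊗ₜ[A] oneTmul E.π V v : I ⊗[A] (baseChange E.π).obj V) = (E.ι i • v : V) :=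
  DFunLike.congr_fun
    (baseChangeLift_oneTmul (N := ModuleCat.of A (I →ₗ[A] E.res.obj V)) (E.mulHom V) v) i

theorem baseChangeTensor_hom_ext {V : ModuleCat.{u} B} {N : ModuleCat.{u} A}
    {f g : E.baseChangeTensor.obj V ⟶ N}
    (h : ∀ (i : I) (v : V), f (i ⊗ₜ[A] oneTmul E.π V v : I ⊗[A] (baseChange E.π).obj V) =
      g (i ⊗ₜ[A] oneTmul E.π V v : I ⊗[A] (baseChange E.π).obj V)) : f = g := by
  ext : 1
  refine TensorProduct.ext' fun i x => ?_
  obtain ⟨v, rfl⟩ := oneTmul_surjective E.π_surjective V x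
  exact h i v

/-- The multiplication `I ⊗_A (A ⊗_B V) ⟶ V` as a natural transformation. -/
def α : E.baseChangeTensor ⟶ E.res where
  app := E.αApp
  naturality V W f := by
    refine E.baseChangeTensor_hom_ext fun i v => ?_
    refine (E.αApp_tmul W i (f v)).trans ?_
    refine Eq.trans ?_ (congrArg (E.res.map f) (E.αApp_tmul V i v)).symm
    exact (map_smul f.hom (E.ι i) v).symm

/-- The projection `V ⟶ A ⊗_B V` as a natural transformation. -/
def β : E.res ⟶ baseChange E.π where
  app V := ModuleCat.ofHom (X := E.res.obj V) (Y := (baseChange E.π).obj V)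
    { toFun := oneTmul E.π V
      map_add' := map_add (oneTmul E.π V)
      map_smul' a v := by
        refine (map_smulₛₗ (oneTmul E.π V) (E.σ a) v).trans ?_
        rw [E.π_σ_apply]
        rfl }
  naturality V W f := by
    ext v
    rfl

theorem α_comp_β : E.α ≫ E.β = 0 := by
  ext V : 2
  refine E.baseChangeTensor_hom_ext fun i v => ?_
  refine (congrArg (E.β.app V) (E.αApp_tmul V i v)).trans ?_
  refine (map_smulₛₗ (oneTmul E.π V) (E.ι i) v).trans ?_
  rw [E.exact.apply_apply_eq_zero, zero_smul]
  rfl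

/-- The projection `V ⟶ coker α` is semilinear, hence it factors through `β`. -/
theorem exact_α_β (V : ModuleCat.{u} B) :
    (ShortComplex.mk (E.α.app V) (E.β.app V) (congr_app E.α_comp_β V)).Exact := by
  rw [ShortComplex.moduleCat_exact_iff]
  intro v hv
  let N : ModuleCat A := ModuleCat.of A (E.res.obj V ⧸ LinearMap.range (E.α.app V).hom)
  let q : E.res.obj V →ₗ[A] N := Submodule.mkQ _
  have hq (b : B) (v : V) : q (b • v : V) = (E.π b • (q v : N) : N) := by
    obtain ⟨i, hi⟩ := (E.exact (b - E.σ (E.π b))).1 (by rw [map_sub, E.π_σ_apply, sub_self])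
    have hi₀ : q (E.ι i • v : V) = 0 :=
      (Submodule.Quotient.mk_eq_zero _).2 ⟨_, E.αApp_tmul V i v⟩
    have hb : (b • v : V) = (E.ι i • v : V) + (E.σ (E.π b) • v : V) := by
      rw [hi, sub_smul, sub_add_cancel]
    rw [hb]
    refine (map_add q _ _).trans ?_
    rw [hi₀, zero_add]
    exact map_smul q (E.π b) (show E.res.obj V from v)
  let q' : V →ₛₗ[E.π] N := { toFun := q, map_add' := map_add q, map_smul' := hq }
  have hv₀ : q v = 0 :=
    (baseChangeLift_oneTmul q' v).symm.trans
      ((congrArg (baseChangeLift q') hv).trans (map_zero (baseChangeLift q').hom))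
  exact (Submodule.Quotient.mk_eq_zero _).1 hv₀

theorem injective_of_apply_tmul {V : Type u} [AddCommGroup V] [Module B V] [Algebra B A]
    [Module B I] [IsScalarTower B A I] [Module.Flat B V] {j : I →ₗ[B] B}
    (hj : Function.Injective j) (f : I ⊗[A] (A ⊗[B] V) →+ V)
    (hf : ∀ i v, f (i ⊗ₜ (1 ⊗ₜ v)) = j i • v) : Function.Injective f := by
  let e := AlgebraTensorModule.cancelBaseChange B A A I V
  let μ : I ⊗[B] V →ₗ[B] V := (TensorProduct.lid B V).toLinearMap ∘ₗ j.rTensor V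
  have hμ : Function.Injective μ :=
    (TensorProduct.lid B V).injective.comp (Module.Flat.rTensor_preserves_injective_linearMap j hj)
  have he (x : I ⊗[B] V) : f (e.symm x) = μ x := by
    induction x using TensorProduct.induction_on with
    | zero => simp
    | tmul i v => simp [e, μ, hf]
    | add x y hx hy => rw [map_add, map_add, map_add, hx, hy]
  have hfe : f = μ ∘ e := funext fun x => by rw [Function.comp_apply, ← he, e.symm_apply_apply]
  rw [hfe]
  exact hμ.comp e.injective

theorem mono_α_app (V : ModuleCat.{u} B) [Module.Flat B V] : Mono (E.α.app V) := by
  rw [ModuleCat.mono_iff_injective]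
  let := E.π.toAlgebra
  let : Module B I := Module.compHom I E.π
  have : IsScalarTower B A I := ⟨fun b a i => mul_smul (E.π b) a i⟩
  let j : I →ₗ[B] B := { E.ι with map_smul' := E.smul_eq }
  exact injective_of_apply_tmul (A := A) (j := j) E.ι_injective
    (E.αApp V).hom.toAddMonoidHom (E.αApp_tmul V)

theorem shortExactOnProjectives : ShortExactOnProjectives E.α E.β E.α_comp_β where
  exact := E.exact_α_β
  epi V := (ModuleCat.epi_iff_surjective _).2 (oneTmul_surjective E.π_surjective V)
  mono V hV :=
    have : Module.Projective B V := (IsProjective.iff_projective V).2 hV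
    E.mono_α_app V

end Multiplication

end SplitExtension

section CohomologicallyBounded

variable {C : Type*} [Category* C] [Abelian C] {K L : CochainComplex C ℤ}

theorem IsCohomologicallyBounded.of_quasiIso (h : IsCohomologicallyBounded L) (f : K ⟶ L)
    [QuasiIso f] : IsCohomologicallyBounded K := by
  obtain ⟨a, b, h⟩ := h
  exact ⟨a, b, fun i hi => (h i hi).of_iso (isoOfQuasiIsoAt f i)⟩

theorem isCohomologicallyBounded_of_bounded (h : IsBoundedAbove K) (h' : IsBoundedBelow K) :
    IsCohomologicallyBounded K := by
  obtain ⟨m, hm⟩ := h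
  obtain ⟨n, hn⟩ := h'
  refine ⟨n, m, fun i hi => (ExactAt.of_isZero ?_).isZero_homology⟩
  obtain hi | hi := hi
  · exact K.isZero_of_isStrictlyGE n i hi
  · exact K.isZero_of_isStrictlyLE m i hi

end CohomologicallyBounded

section Hypertor

variable {A B : Type u} [CommRing A] [CommRing B] (π : B →+* A)

theorem nonempty_homotopyEquiv_derivedPullback {K P : CochainComplex (ModuleCat.{u} B) ℤ}
    (hK : IsBoundedAbove K) (hP : IsBoundedAbove P) [∀ i, Projective (P.X i)]
    (h : DerivedIso K P) :
    Nonempty (HomotopyEquiv (derivedPullback π K hK) ((pullback π).obj P)) := by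
  have := (projRes K hK).isKProjective
  have := hP.isKProjective
  obtain ⟨e⟩ := ((projRes K hK).derivedIso.trans h).nonempty_homotopyEquiv
  exact ⟨(baseChange π).mapHomotopyEquiv e⟩

theorem bijective_hypertorTo_iff {K : CochainComplex (ModuleCat.{u} B) ℤ} (hK : IsBoundedAbove K)
    (i : ℤ) : Function.Bijective (hypertorTo π K hK i) ↔
      IsIso (homologyMap (derivedPullbackTo π K hK) (-i)) :=
  (ConcreteCategory.isIso_iff_bijective (hypertorTo π K hK i)).symm

theorem surjective_hypertorTo_iff {K : CochainComplex (ModuleCat.{u} B) ℤ} (hK : IsBoundedAbove K)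
    (i : ℤ) : Function.Surjective (hypertorTo π K hK i) ↔
      Epi (homologyMap (derivedPullbackTo π K hK) (-i)) :=
  (ModuleCat.epi_iff_surjective (hypertorTo π K hK i)).symm

variable (K : CochainComplex (ModuleCat.{u} B) ℤ)

theorem isNAdmissible_top_iff : IsNAdmissible π ⊤ K ↔ ∀ n : ℕ, IsNAdmissible π n K :=
  ⟨fun h _ i _ => h i (ENat.natCast_lt_top i), fun h i _ => h (i + 1) i (by norm_cast; lia)⟩

theorem exactAt_torOne_of_pos [K.IsStrictlyLE 0] {j : ℤ} (hj : 0 < j) :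
    (torOne π K).ExactAt j :=
  .of_isZero ((tor π 1).map_isZero (K.isZero_of_isStrictlyLE 0 j hj))

theorem isNAdmissible_natCast_iff [K.IsStrictlyLE 0] (n : ℕ) :
    IsNAdmissible π n K ↔ ∀ i : ℤ, i < n → (torOne π K).ExactAt (-i) := by
  simp only [IsNAdmissible, ← exactAt_iff_isZero_homology, Nat.cast_lt]
  refine ⟨fun h i hi => ?_, fun h i hi => h i (by exact_mod_cast hi)⟩
  obtain hi₀ | hi₀ := lt_or_ge i 0
  · exact exactAt_torOne_of_pos π K (by lia)
  · lift i to ℕ using hi₀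
    exact h i (by exact_mod_cast hi)

end Hypertor

namespace SplitExtension

variable {A B I : Type u} [CommRing A] [CommRing B] [AddCommGroup I] [Module A I]
  [Module.Flat A I] (E : SplitExtension A B I)

section Admissible

variable {K : CochainComplex (ModuleCat.{u} B) ℤ} (hK : IsBoundedAbove K)

theorem forall_exactAt_mappingCone_derivedPullbackTo_iff (a : ℤ) :
    (∀ j, a ≤ j → (mappingCone (derivedPullbackTo E.π K hK)).ExactAt j) ↔
      ∀ j, a ≤ j → (torOne E.π K).ExactAt (j + 2) :=
  have := (projRes K hK).quasiIso
  have := (projRes K hK).projective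
  E.shortExactOnProjectives.forall_exactAt_mappingCone_map_iff (projRes K hK).f
    (projRes K hK).boundedAbove hK a

theorem hypertorTo_bijective_and_surjective_iff (r : ℤ) :
    (∀ i < r, Function.Bijective (hypertorTo E.π K hK i)) ∧
        Function.Surjective (hypertorTo E.π K hK r) ↔
      ∀ i : ℤ, i + 1 < r → (torOne E.π K).ExactAt (-i) := by
  have hcone := (forall_exactAt_mappingCone_iff (derivedPullbackTo E.π K hK) (-r)).symm.trans
    (E.forall_exactAt_mappingCone_derivedPullbackTo_iff hK (-r))
  simp only [bijective_hypertorTo_iff, surjective_hypertorTo_iff]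
  trans ∀ j, -r ≤ j → (torOne E.π K).ExactAt (j + 2)
  · rw [← hcone, and_comm]
    refine and_congr_right fun _ => ⟨fun h j hj => ?_, fun h i hi => h (-i) (by lia)⟩
    exact neg_neg j ▸ h (-j) (by lia)
  · refine ⟨fun h i hi => ?_, fun h j hj => ?_⟩
    · simpa only [sub_add_cancel] using h (-i - 2) (by lia)
    · simpa only [neg_neg] using h (-(j + 2)) (by lia)

theorem bijective_hypertorTo_of_neg [K.IsStrictlyLE 0] {i : ℤ} (hi : i < 0) :
    Function.Bijective (hypertorTo E.π K hK i) :=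
  ((E.hypertorTo_bijective_and_surjective_iff hK 0).2
    fun _ _ => exactAt_torOne_of_pos E.π K (by lia)).1 i hi

theorem isNAdmissible_natCast_iff_hypertorTo [K.IsStrictlyLE 0] (n : ℕ) :
    IsNAdmissible E.π n K ↔
      (∀ i : ℕ, i ≤ n → Function.Bijective (hypertorTo E.π K hK i)) ∧
        Function.Surjective (hypertorTo E.π K hK (n + 1)) := by
  have h := E.hypertorTo_bijective_and_surjective_iff hK (n + 1)
  simp only [add_lt_add_iff_right] at h
  rw [isNAdmissible_natCast_iff, ← h]
  refine and_congr_left fun _ => ⟨fun h i hi => h i (by lia), fun h i hi => ?_⟩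
  obtain hi₀ | hi₀ := lt_or_ge i 0
  · exact E.bijective_hypertorTo_of_neg hK hi₀
  · lift i to ℕ using hi₀
    exact h i (by lia)

theorem isNAdmissible_iff [K.IsStrictlyLE 0] (n : ℕ∞) :
    IsNAdmissible E.π n K ↔
      (∀ i : ℕ, (i : ℕ∞) ≤ n → Function.Bijective (hypertorTo E.π K hK i)) ∧
        (∀ i : ℕ, (i : ℕ∞) = n + 1 → Function.Surjective (hypertorTo E.π K hK i)) := by
  induction n with
  | top =>
    simp only [isNAdmissible_top_iff, E.isNAdmissible_natCast_iff_hypertorTo hK, le_top,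
      forall_const, top_add, ENat.natCast_ne_top, false_implies, and_true]
    exact ⟨fun h i => (h i).1 i le_rfl, fun h n => ⟨fun i _ => h i, (h (n + 1)).2⟩⟩
  | coe n =>
    rw [E.isNAdmissible_natCast_iff_hypertorTo hK]
    norm_cast
    rw [forall_eq]
    rfl

theorem quasiIso_derivedPullbackTo (h : IsAdmissible E.π K) :
    QuasiIso (derivedPullbackTo E.π K hK) :=
  (acyclic_mappingCone_iff _).1 fun i =>
    (E.forall_exactAt_mappingCone_derivedPullbackTo_iff hK i).2
      (fun _ _ => (exactAt_iff_isZero_homology _ _).2 (h _)) i le_rfl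

theorem isCohomologicallyBounded_derivedPullback (hK' : IsBoundedBelow K)
    (h : IsAdmissible E.π K) : IsCohomologicallyBounded (derivedPullback E.π K hK) :=
  have := E.quasiIso_derivedPullbackTo hK h
  (isCohomologicallyBounded_of_bounded (pullback_isBoundedAbove E.π hK)
    (pullback_isBoundedBelow E.π hK')).of_quasiIso (derivedPullbackTo E.π K hK)

end Admissible

section Truncation

variable {P : CochainComplex (ModuleCat.{u} B) ℤ} [∀ i, Projective (P.X i)]

theorem isGE_of_exactAt_pullback {n : ℤ} (h : ∀ i < n, ((pullback E.π).obj P).ExactAt i) :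
    P.IsGE n :=
  (isGE_iff P n).2 fun i hi => E.shortExactOnProjectives.exactAt_of_exactAt_map (h i hi)

/-- All terms of `P.truncGE n` are zero or projective, except the one in degree `n`, whose `Tor₁`
vanishes because `I ⊗ P.opcycles n ⟶ P.opcycles n` is injective. -/
theorem isAdmissible_truncGE {n : ℤ} (h : ((pullback E.π).obj P).ExactAt (n - 1)) :
    IsAdmissible E.π (P.truncGE n) := by
  refine fun i => (ExactAt.of_isZero ?_).isZero_homology
  change IsZero ((tor E.π 1).obj ((P.truncGE n).X i))
  obtain hi | rfl | hi := lt_trichotomy i n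
  · exact (tor E.π 1).map_isZero ((P.truncGE n).isZero_of_isStrictlyGE n i hi)
  · have := E.shortExactOnProjectives.mono_app_opcycles (sub_add_cancel i 1) h
    exact (E.shortExactOnProjectives.isZero_leftDerived_one_obj (P.opcycles i)).of_iso
      ((tor E.π 1).mapIso (P.truncGEXIsoOpcycles i))
  · exact ((baseChange E.π).isZero_leftDerived_obj_projective_succ 0 (P.X i)).of_iso
      ((tor E.π 1).mapIso (P.truncGEXIso n i hi))

end Truncation

theorem exists_isAdmissible_iff (K : CochainComplex (ModuleCat.{u} B) ℤ) (m : ℤ)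
    (hK : K.IsStrictlyLE m) :
    (∃ L : CochainComplex (ModuleCat.{u} B) ℤ, L.IsStrictlyLE m ∧ IsBoundedBelow L ∧
      IsAdmissible E.π L ∧ DerivedIso K L) ↔
    IsCohomologicallyBounded (derivedPullback E.π K ⟨m, hK⟩) := by
  constructor
  · rintro ⟨L, hL, hL', hadm, hKL⟩
    let R := projRes L ⟨m, hL⟩
    have := R.projective
    obtain ⟨e⟩ : Nonempty (HomotopyEquiv (derivedPullback E.π K ⟨m, hK⟩)
        (derivedPullback E.π L ⟨m, hL⟩)) :=
      nonempty_homotopyEquiv_derivedPullback E.π ⟨m, hK⟩ R.boundedAbove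
        (hKL.trans R.derivedIso.symm)
    have := e.quasiIso_hom
    exact (E.isCohomologicallyBounded_derivedPullback ⟨m, hL⟩ hL' hadm).of_quasiIso e.hom
  · intro h
    obtain ⟨P, f, hPm, hP, hf⟩ := exists_projective_quasiIso K m
    have hKP : DerivedIso K P := (DerivedIso.of_quasiIso f).symm
    obtain ⟨e⟩ := nonempty_homotopyEquiv_derivedPullback E.π ⟨m, hK⟩ ⟨m, hPm⟩ hKP
    have := e.quasiIso_inv
    obtain ⟨a, _, hab⟩ := h.of_quasiIso e.inv
    have hex (i : ℤ) (hi : i < min a m) : ((pullback E.π).obj P).ExactAt i :=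
      (exactAt_iff_isZero_homology _ _).2 (hab i (.inl (by lia)))
    have := E.isGE_of_exactAt_pullback hex
    refine ⟨P.truncGE (min a m), ?_, ⟨min a m, inferInstance⟩,
      E.isAdmissible_truncGE (hex _ (by lia)), hKP.trans (.of_quasiIso (P.πTruncGE (min a m)))⟩
    exact (isStrictlyLE_iff _ _).2 fun i hi =>
      (P.isZero_of_isStrictlyLE m i hi).of_iso (P.truncGEXIso _ i (by lia))

end SplitExtension

section Perfect

variable {R : Type u} [CommRing R] {P Q : CochainComplex (ModuleCat.{u} R) ℤ}

/-- A bounded complex of finitely generated projective modules. -/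
structure IsStrictlyPerfect (P : CochainComplex (ModuleCat.{u} R) ℤ) : Prop where
  boundedAbove : IsBoundedAbove P
  boundedBelow : IsBoundedBelow P
  finite (i : ℤ) : Module.Finite R (P.X i)
  projective (i : ℤ) : Projective (P.X i)

theorem isPerfect_iff (K : CochainComplex (ModuleCat.{u} R) ℤ) :
    IsPerfect K ↔ ∃ P, IsStrictlyPerfect P ∧ DerivedIso K P := by
  constructor
  · rintro ⟨P, hP, hP', hX, h⟩
    exact ⟨P, ⟨hP, hP', fun i => (hX i).1, fun i => have := (hX i).2; inferInstance⟩, h⟩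
  · rintro ⟨P, hP, h⟩
    have (i : ℤ) : Module.Projective R (P.X i) := have := hP.projective i; inferInstance
    exact ⟨P, hP.boundedAbove, hP.boundedBelow, fun i => ⟨hP.finite i, this i⟩, h⟩

theorem IsStrictlyPerfect.of_iso_X (hP : IsStrictlyPerfect P)
    (e : ∀ i, Nonempty (Q.X i ≅ P.X i)) : IsStrictlyPerfect Q where
  boundedAbove := by
    obtain ⟨m, hm⟩ := hP.boundedAbove
    exact ⟨m, (isStrictlyLE_iff _ _).2 fun i hi =>
      (P.isZero_of_isStrictlyLE m i hi).of_iso (e i).some⟩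
  boundedBelow := by
    obtain ⟨m, hm⟩ := hP.boundedBelow
    exact ⟨m, (isStrictlyGE_iff _ _).2 fun i hi =>
      (P.isZero_of_isStrictlyGE m i hi).of_iso (e i).some⟩
  finite i :=
    have := hP.finite i
    Module.Finite.equiv (e i).some.symm.toLinearEquiv
  projective i := Projective.of_iso (e i).some.symm (hP.projective i)

variable {A B : Type u} [CommRing A] [CommRing B] (π : B →+* A)

theorem IsStrictlyPerfect.pullback {P : CochainComplex (ModuleCat.{u} B) ℤ}
    (hP : IsStrictlyPerfect P) : IsStrictlyPerfect ((DerivedPullback.pullback π).obj P) where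
  boundedAbove := pullback_isBoundedAbove π hP.boundedAbove
  boundedBelow := pullback_isBoundedBelow π hP.boundedBelow
  finite i :=
    have := hP.finite i
    inferInstanceAs (Module.Finite A ((baseChange π).obj (P.X i)))
  projective i :=
    have := hP.projective i
    inferInstance

theorem isPerfect_derivedPullback {K : CochainComplex (ModuleCat.{u} B) ℤ} (hK : IsBoundedAbove K)
    (h : IsPerfect K) : IsPerfect (derivedPullback π K hK) := by
  obtain ⟨P, hP, hKP⟩ := (isPerfect_iff K).1 h
  have := hP.projective
  obtain ⟨e⟩ := nonempty_homotopyEquiv_derivedPullback π hK hP.boundedAbove hKP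
  exact (isPerfect_iff _).2 ⟨_, hP.pullback π, .of_homotopyEquiv e⟩

end Perfect

namespace SplitExtension

section Perfect

variable {A B I : Type u} [CommRing A] [CommRing B] [AddCommGroup I] [Module A I]
  [Module.Flat A I] (E : SplitExtension A B I)

/-- The base change of `Q` along the section is a first approximation to the lift of `Q`. -/
theorem exists_isStrictlyPerfect_quasiIso {P : CochainComplex (ModuleCat.{u} B) ℤ}
    [∀ i, Projective (P.X i)] {Q : CochainComplex (ModuleCat.{u} A) ℤ} (hQ : IsStrictlyPerfect Q)
    (e : HomotopyEquiv ((pullback E.π).obj P) Q) :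
    ∃ (Q' : CochainComplex (ModuleCat.{u} B) ℤ) (f : Q' ⟶ P),
      IsStrictlyPerfect Q' ∧ QuasiIso f := by
  have hσQ := hQ.pullback E.σ
  have (i : ℤ) := hσQ.projective i
  let e' : HomotopyEquiv (((baseChange E.π).mapHomologicalComplex (.up ℤ)).obj P)
      (((baseChange E.π).mapHomologicalComplex (.up ℤ)).obj ((pullback E.σ).obj Q)) :=
    e.trans (.ofIso (pullbackSectionIso E.π E.σ E.π_σ Q).symm)
  obtain ⟨Q', hQ', f, φ, hf⟩ := exists_lift_of_homotopyEquiv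
    E.shortExactOnProjectives.hasSquareZeroKernel
    (fun i Y => baseChange_map_surjective E.π_surjective (P.X i) Y)
    (fun i Y => baseChange_map_surjective E.π_surjective _ Y) e'
  have hQ'' := hσQ.of_iso_X hQ'
  have := hQ''.projective
  have := e'.quasiIso_inv
  have : QuasiIso (((baseChange E.π).mapHomologicalComplex (.up ℤ)).map f) := by
    rw [hf]
    infer_instance
  exact ⟨Q', f, hQ'', E.shortExactOnProjectives.quasiIso_of_quasiIso_map f⟩

theorem isPerfect_iff_isPerfect_derivedPullback {K : CochainComplex (ModuleCat.{u} B) ℤ}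
    (hK : IsBoundedAbove K) : IsPerfect K ↔ IsPerfect (derivedPullback E.π K hK) := by
  refine ⟨isPerfect_derivedPullback E.π hK, fun h => ?_⟩
  obtain ⟨Q, hQ, hKQ⟩ := (isPerfect_iff _).1 h
  let R := projRes K hK
  have := R.projective
  have := hQ.projective
  have : (derivedPullback E.π K hK).IsKProjective :=
    IsBoundedAbove.isKProjective (P := (pullback E.π).obj R.P)
      (pullback_isBoundedAbove E.π R.boundedAbove)
  have := hQ.boundedAbove.isKProjective
  obtain ⟨e⟩ := hKQ.nonempty_homotopyEquiv
  obtain ⟨Q', f, hQ', _⟩ := E.exists_isStrictlyPerfect_quasiIso (P := R.P) hQ e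
  exact (isPerfect_iff K).2 ⟨Q', hQ', R.derivedIso.symm.trans (DerivedIso.of_quasiIso f).symm⟩

end Perfect

section Constructions

variable {A B : Type u} {I : Type w} [CommRing A] [CommRing B] [AddCommGroup I] [Module A I]

/-- The same extension, with the kernel moved to the universe of `B`, which contains it. -/
def shrink (E : SplitExtension A B I) [Small.{u} I] : SplitExtension A B (Shrink.{u} I) where
  ι := E.ι.comp (Shrink.addEquiv (α := I)).toAddMonoidHom
  π := E.π
  σ := E.σ
  ι_injective := E.ι_injective.comp (Shrink.addEquiv (α := I)).injective
  exact b := (E.exact b).trans <| iff_of_eq <| congrArg (b ∈ ·) <|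
    (EquivLike.range_comp E.ι (Shrink.addEquiv (α := I))).symm
  smul_eq b i := (congrArg E.ι (map_smul (Shrink.linearEquiv A I) _ i)).trans (E.smul_eq b _)
  π_σ := E.π_σ

/-- A trivial extension with a chosen section, its `k`-algebra structures being forgotten. -/
def ofTrivial {k : Type v} [Field k] [Algebra k A] [Algebra k B] (E : TrivialExtension k A B I) :
    SplitExtension A B I where
  ι := E.ι
  π := E.π.toRingHom
  σ := E.split.choose.toRingHom
  ι_injective := E.ι_injective
  exact := E.exact
  smul_eq := E.smul_eq
  π_σ := congrArg AlgHom.toRingHom E.split.choose_spec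

end Constructions

end SplitExtension

end DerivedPullback

end

open DerivedPullback in
theorem proposition4p16_general {A B : Type u} {I : Type w} [CommRing A] [CommRing B]
    [AddCommGroup I] [Module A I] [Module.Flat A I] (E : SplitExtension A B I) :
    (∀ (K : CochainComplex (ModuleCat.{u} B) ℤ) (hK : K.IsStrictlyLE 0) (n : ℕ∞),
      IsNAdmissible E.π n K ↔
        (∀ i : ℕ, (i : ℕ∞) ≤ n → Function.Bijective (hypertorTo E.π K ⟨0, hK⟩ i)) ∧
        (∀ i : ℕ, (i : ℕ∞) = n + 1 → Function.Surjective (hypertorTo E.π K ⟨0, hK⟩ i))) ∧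
    (∀ (K : CochainComplex (ModuleCat.{u} B) ℤ) (m : ℤ) (hK : K.IsStrictlyLE m),
      (∃ L : CochainComplex (ModuleCat.{u} B) ℤ, L.IsStrictlyLE m ∧ IsBoundedBelow L ∧
        IsAdmissible E.π L ∧ DerivedIso K L) ↔
      IsCohomologicallyBounded (derivedPullback E.π K ⟨m, hK⟩)) ∧
    (∀ (K : CochainComplex (ModuleCat.{u} B) ℤ) (hK : IsBoundedAbove K),
      IsPerfect K ↔ IsPerfect (derivedPullback E.π K hK)) := by
  have := small_of_injective E.ι_injective
  have : Module.Flat A (Shrink.{u} I) := .of_linearEquiv (Shrink.linearEquiv A I)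
  exact ⟨fun _ hK n => E.shrink.isNAdmissible_iff ⟨0, hK⟩ n, E.shrink.exists_isAdmissible_iff,
    fun _ hK => E.shrink.isPerfect_iff_isPerfect_derivedPullback hK⟩

open DerivedPullback in
theorem proposition4p16 {k : Type v} {A B : Type u} {I : Type w} [Field k] [CharZero k]
    [CommRing A] [Algebra k A] [CommRing B] [Algebra k B] [AddCommGroup I] [Module A I]
    [Module.Free A I] [Module.Finite A I] (E : TrivialExtension k A B I) :
    -- `n`-admissibility in terms of hypertor
    (∀ (K : CochainComplex (ModuleCat.{u} B) ℤ) (hK : K.IsStrictlyLE 0) (n : ℕ∞),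
      IsNAdmissible E.π.toRingHom n K ↔
        (∀ i : ℕ, (i : ℕ∞) ≤ n →
          Function.Bijective (hypertorTo E.π.toRingHom K ⟨0, hK⟩ i)) ∧
        (∀ i : ℕ, (i : ℕ∞) = n + 1 →
          Function.Surjective (hypertorTo E.π.toRingHom K ⟨0, hK⟩ i))) ∧
    -- complexes isomorphic in the derived category to a bounded admissible one
    (∀ (K : CochainComplex (ModuleCat.{u} B) ℤ) (m : ℤ) (hK : K.IsStrictlyLE m),
      (∃ L : CochainComplex (ModuleCat.{u} B) ℤ, L.IsStrictlyLE m ∧ IsBoundedBelow L ∧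
        IsAdmissible E.π.toRingHom L ∧ DerivedIso K L) ↔
      IsCohomologicallyBounded (derivedPullback E.π.toRingHom K ⟨m, hK⟩)) ∧
    -- perfect complexes
    (∀ (K : CochainComplex (ModuleCat.{u} B) ℤ) (hK : IsBoundedAbove K), IsBoundedBelow K →
      (IsPerfect K ↔ IsPerfect (derivedPullback E.π.toRingHom K hK))) := by
  have h := proposition4p16_general (.ofTrivial E)
  exact ⟨h.1, h.2.1, fun K hK _ => h.2.2 K hK⟩
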